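/- Proposition 5.13 (label "prop_sphereStrictBarrier"). Let $\varphi$ be a smooth real function near $0$ with $\varphi(0)=0$ and $\varphi'(0)>0$, and let $U\subset\mathbb{R}^3$ be an open neighbourhood of the origin $O$. Let $M=\{(x,z)\in U: z\le-\varphi(|x|^2)\}$, where $x=(x_1,x_2)$, with boundary $\partial M=\{(x,z)\in U: z=-\varphi(|x|^2)\}$ (a spherical pole at $O$), and let $g$ be a Riemannian metric on $M$, smooth up to $\partial M$. Let $g_0=g(0)=(a_{ij})$ with inverse $(a^{ij})$, and suppose that the coordinates have been rotated about the $x_3$-axis so that $a_{12}=0$. Put $b_\alpha=\sqrt{a_{\alpha\alpha}a^{33}}$ for $\alpha=1,2$, and for $s\ge0$, $t>0$ let $$G_{s,t}(x)=\varphi'(0)(b_1-1+s)x_1^2+\varphi'(0)(b_2-1+s)x_2^2-t^2 .$$ For $\rho>0$ let $\Sigma_{s,t}=\{(x,G_{s,t}(x)): |x|<\rho,\ G_{s,t}(x)<-\varphi(|x|^2)\}$ and $\partial\Sigma_{s,t}=\{(x,G_{s,t}(x)): |x|<\rho,\ G_{s,t}(x)=-\varphi(|x|^2)\}$. Let $H_{s,t}$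 be the mean curvature of $\Sigma_{s,t}$ with respect to $g$, that is, the trace of $\nabla N$ for the upward $g$-unit normal $N$. Along $\partial\Sigma_{s,t}$ let $\gamma_{s,t}\in[0,\pi]$ be the angle with respect to $g$ between $N$ and the outward $g$-unit normal of $\partial M$, and let $\bar\gamma\in[0,\pi]$ be the Euclidean angle between $e_3$ and the outward Euclidean unit normal of $\partial M$. Then there is a constant $H_0\in\mathbb{R}$ such that $H_{0,t}(x)$, the mean curvature at the point $(x,G_{0,t}(x))$, tends to $H_0$ as $t\downarrow0$ and $x\to0$ with $G_{0,t}(x)<-\varphi(|x|^2)$. If $H_0>0$, then there is $\rho_0>0$ such that for every $\rho\in(0,\rho_0]$ there are $s>0$ and $t>0$ with the following properties: 1. every $x$ with $|x|\le\rho$ and $G_{s,t}(x)\le-\varphi(|x|^2)$ satisfies $|x|<\rho$ and $(x,G_{s,t}(x))\in M$, so that $\Sigma_{s,t}\cup\partial\Sigma_{s,t}$ is a compact subset of $M$ and $\partial\Sigma_{s,t}\subset\partial M$; 2. $H_{s,t}>0$ at every point of $\Sigma_{s,t}$; 3. $\gamma_{s,t}>\bar\gamma$ at every point of $\partial\Sigma_{s,t}$.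 In particular this applies when $g_0\ne\delta$, where $\delta$ is the Euclidean metric. -/

import Mathlib

open Filter Topology
open scoped ContDiff Matrix

noncomputable section

namespace SphericalPole

/-- The horizontal plane, with coordinates `x 0, x 1`. -/
abbrev Plane := Fin 2 → ℝ

/-- Euclidean three-space, with coordinates `p 0, p 1, p 2`; the last one is the vertical one. -/
abbrev Space := Fin 3 → ℝ

/-- A field of `3 × 3` matrices `g p i j`: a metric tensor in the coordinates of `Space`. -/
abbrev MetricField := Space → Matrix (Fin 3) (Fin 3) ℝ

/-- The squared Euclidean length of a point of the plane. -/
def sqNorm (x : Plane) : ℝ := x 0 ^ 2 + x 1 ^ 2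

/-- The height function `-φ(|x|²)` of the boundary near the pole. -/
def boundaryHeight (φ : ℝ → ℝ) (x : Plane) : ℝ := -φ (sqNorm x)

/-- The part in `U` of the manifold with boundary lying below the graph of `-φ(|x|²)`. -/
def localBody (φ : ℝ → ℝ) (U : Set Space) : Set Space :=
  {p | p ∈ U ∧ p 2 ≤ boundaryHeight φ ![p 0, p 1]}

/-! ### Geometry of surfaces in a Riemannian metric -/

/-- The inner product of two vectors for the symmetric matrix `A`. -/
def gInner (A : Matrix (Fin 3) (Fin 3) ℝ) (v w : Space) : ℝ := v ⬝ᵥ (A *ᵥ w)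

/-- The partial derivative `∂_k g_ij` at `p`. -/
def dMetric (g : MetricField) (p : Space) (k i j : Fin 3) : ℝ :=
  fderiv ℝ (fun q => g q i j) p (Pi.single k 1)

/-- The Christoffel symbol `Γ^k_ij` of the Levi-Civita connection of `g`. -/
def christoffel (g : MetricField) (p : Space) (i j k : Fin 3) : ℝ :=
  (1 / 2) * ∑ l, (g p)⁻¹ k l * (dMetric g p i j l + dMetric g p j i l - dMetric g p l i j)

/-- The coordinate tangent vector `∂_α F` of a parametrized surface. -/
def tangent (F : Plane → Space) (α : Fin 2) (x : Plane) : Space :=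
  fderiv ℝ F x (Pi.single α 1)

/-- The ambient covariant derivative `∇_{∂_α F} ∂_β F` along a parametrized surface. -/
def covDeriv (g : MetricField) (F : Plane → Space) (α β : Fin 2) (x : Plane) : Space :=
  fun k => fderiv ℝ (tangent F β) x (Pi.single α 1) k
    + ∑ i, ∑ j, christoffel g (F x) i j k * tangent F α x i * tangent F β x j

/-- The first fundamental form of a parametrized surface. -/
def firstForm (g : MetricField) (F : Plane → Space) (x : Plane) : Matrix (Fin 2) (Fin 2) ℝ :=
  Matrix.of fun α β => gInner (g (F x)) (tangent F α x) (tangent F β x)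

/-- The mean curvature `-g^{αβ} ⟨∇_{∂_α F} ∂_β F, N⟩`, the trace of `∇N`, of a parametrized
surface with unit normal `N` at the point with parameter `x`. -/
def meanCurvature (g : MetricField) (F : Plane → Space) (N : Plane → Space) (x : Plane) : ℝ :=
  -∑ α, ∑ β, (firstForm g F x)⁻¹ α β * gInner (g (F x)) (covDeriv g F α β x) (N x)

/-- The unit vector, for the inner product `A`, that is `A`-orthogonal to the kernel of the
nonzero covector `ν` and on which `ν` is positive. -/
def unitNormal (A : Matrix (Fin 3) (Fin 3) ℝ) (ν : Space) : Space :=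
  (√(ν ⬝ᵥ (A⁻¹ *ᵥ ν)))⁻¹ • (A⁻¹ *ᵥ ν)

/-- The graph of `f` as a parametrized surface. -/
def graphMap (f : Plane → ℝ) (x : Plane) : Space := ![x 0, x 1, f x]

/-- The differential of `p ↦ p 2 - f (p 0, p 1)`: it vanishes on the tangent plane of the graph of
`f` over `x` and is positive on vectors pointing upwards from the graph. -/
def graphConormal (f : Plane → ℝ) (x : Plane) : Space :=
  ![-fderiv ℝ f x (Pi.single 0 1), -fderiv ℝ f x (Pi.single 1 1), 1]

/-- The mean curvature of the graph of `f` for its upward unit normal. -/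
def graphMeanCurvature (g : MetricField) (f : Plane → ℝ) (x : Plane) : ℝ :=
  meanCurvature g (graphMap f)
    (fun y => unitNormal (g (graphMap f y)) (graphConormal f y)) x

/-- The angle in `[0, π]` between the unit normals, for the inner product `A`, that are determined
by two covectors. -/
def normalAngle (A : Matrix (Fin 3) (Fin 3) ℝ) (μ ν : Space) : ℝ :=
  Real.arccos (gInner A (unitNormal A μ) (unitNormal A ν))

/-! ### The paraboloids -/

/-- The number `b_α = √(a_αα a³³)`, where `a = A` is the metric at the pole and `a³³` is the last
diagonal entry of the inverse matrix. -/
def bCoeff (A : Matrix (Fin 3) (Fin 3) ℝ) (i : Fin 3) : ℝ := √(A i i * A⁻¹ 2 2)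

/-- `G_{s,t}(x) = φ'(0) (b₁ - 1 + s) x₁² + φ'(0) (b₂ - 1 + s) x₂² - t²`. -/
def paraboloid (φ : ℝ → ℝ) (A : Matrix (Fin 3) (Fin 3) ℝ) (s t : ℝ) (x : Plane) : ℝ :=
  deriv φ 0 * x 0 ^ 2 * (bCoeff A 0 - 1 + s) + deriv φ 0 * x 1 ^ 2 * (bCoeff A 1 - 1 + s) - t ^ 2

/-- The points of the disk of radius `ρ` over which the graph of `G_{s,t}` lies strictly below the
boundary of the body: the projection of the interior of the surface `Σ_{s,t}`. -/
def surfaceBase (φ : ℝ → ℝ) (A : Matrix (Fin 3) (Fin 3) ℝ) (ρ s t : ℝ) : Set Plane :=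
  {x | sqNorm x < ρ ^ 2 ∧ paraboloid φ A s t x < boundaryHeight φ x}

/-- The points of the disk of radius `ρ` over which the graph of `G_{s,t}` meets the
boundary of the body: the projection of the boundary curve of the surface `Σ_{s,t}`. -/
def boundaryBase (φ : ℝ → ℝ) (A : Matrix (Fin 3) (Fin 3) ℝ) (ρ s t : ℝ) : Set Plane :=
  {x | sqNorm x < ρ ^ 2 ∧ paraboloid φ A s t x = boundaryHeight φ x}

/-- The mean curvature `H_{s,t}` of `Σ_{s,t}` in the metric `g` at its point over `x`. -/
def surfaceH (φ : ℝ → ℝ) (g : MetricField) (s t : ℝ) (x : Plane) : ℝ :=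
  graphMeanCurvature g (paraboloid φ (g 0) s t) x

/-- The contact angle `γ_{s,t}` in the metric `g` at the boundary point over `x`: the angle between
the outward unit normal of the boundary of the body and the upward unit normal of `Σ_{s,t}`. -/
def contactAngle (φ : ℝ → ℝ) (g : MetricField) (s t : ℝ) (x : Plane) : ℝ :=
  normalAngle (g (graphMap (boundaryHeight φ) x))
    (graphConormal (boundaryHeight φ) x) (graphConormal (paraboloid φ (g 0) s t) x)

/-- The model angle `γ̄` at the boundary point over `x`: the Euclidean angle between the outward unit
normal of the boundary and the vertical vector, the normal of the horizontal planes. -/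
def modelAngle (φ : ℝ → ℝ) (x : Plane) : ℝ :=
  normalAngle 1 (graphConormal (boundaryHeight φ) x) ![0, 0, 1]

end SphericalPole

end

open SphericalPole

/-! The mean curvature depends continuously on the 1-jet of the metric and on the gradient and
Hessian of the graph. As `(s, t, x)` tends to 0 inside the body, the gradient of `G_{s,t}` vanishes,
its Hessian converges, and `g` and its first derivatives have limits because `g` is smooth up to the
boundary. So `H_{s,t}(x)` has one joint limit `H₀` (`exists_tendsto_surfaceH`); if `H₀ > 0`,
positivity persists for all small `s`, `t`, `x`.

For the angles, let `μ` and `ν` be the conormals of the boundary and of the paraboloid. Their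
difference is horizontal and linear in `x` up to convergent factors, so the Gram determinant of `μ,
ν` in the dual metric is a quadratic form in `x`. After subtracting the contribution of the
Euclidean cosine, the form tends to a diagonal one: `a₁₂ = 0` kills the cross term, and the other
entries are positive multiples of `(b_α + s)² - b_α²`. The `b_α` are thus the critical slopes, and
any `s > 0` gives the strict inequality near the pole, uniformly in `t`
(`eventually_modelAngle_lt_contactAngle`).

Finally `φ(r) = φ'(0) r + o(r)` confines the surface to a disk of radius `O(t)`
(`exists_sqNorm_le_of_paraboloid_le`). Hence `s` is fixed first, and then `t` is taken small
depending on `s` and `ρ`. -/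

namespace SphericalPole

/-! ### Derivatives of quadratic graphs -/

/-- The quadratic polynomial `c₀ x₀² + c₁ x₁² - d`. -/
def diagQuadratic (c : Fin 2 → ℝ) (d : ℝ) (x : Plane) : ℝ := c 0 * x 0 ^ 2 + c 1 * x 1 ^ 2 - d

lemma hasFDerivAt_coord {n : ℕ} (i : Fin n) (x : Fin n → ℝ) :
    HasFDerivAt (fun y : Fin n → ℝ => y i)
      (ContinuousLinearMap.proj (R := ℝ) (φ := fun _ : Fin n => ℝ) i) x :=
  (ContinuousLinearMap.proj (R := ℝ) (φ := fun _ : Fin n => ℝ) i).hasFDerivAt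

lemma hasFDerivAt_diagQuadratic (c : Fin 2 → ℝ) (d : ℝ) (x : Plane) :
    HasFDerivAt (diagQuadratic c d)
      ((2 * c 0 * x 0) • ContinuousLinearMap.proj (R := ℝ) (φ := fun _ : Fin 2 => ℝ) 0
        + (2 * c 1 * x 1) • ContinuousLinearMap.proj (R := ℝ) (φ := fun _ : Fin 2 => ℝ) 1) x := by
  have h := ((((hasFDerivAt_coord 0 x).pow 2).const_mul (c 0)).add
    (((hasFDerivAt_coord 1 x).pow 2).const_mul (c 1))).sub_const d
  refine h.congr_fderiv ?_
  ext v
  simp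
  ring

lemma fderiv_diagQuadratic (c : Fin 2 → ℝ) (d : ℝ) (x : Plane) (α : Fin 2) :
    fderiv ℝ (diagQuadratic c d) x (Pi.single α 1) = 2 * c α * x α := by
  rw [(hasFDerivAt_diagQuadratic c d x).fderiv]
  fin_cases α <;> simp

lemma tangent_diagQuadratic (c : Fin 2 → ℝ) (d : ℝ) (α : Fin 2) :
    tangent (graphMap (diagQuadratic c d)) α = fun x =>
      ![(Pi.single α 1 : Plane) 0, (Pi.single α 1 : Plane) 1, 2 * c α * x α] := by
  funext x
  have h : HasFDerivAt (graphMap (diagQuadratic c d))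
      (ContinuousLinearMap.pi ![ContinuousLinearMap.proj (R := ℝ) (φ := fun _ : Fin 2 => ℝ) 0,
        ContinuousLinearMap.proj (R := ℝ) (φ := fun _ : Fin 2 => ℝ) 1,
        fderiv ℝ (diagQuadratic c d) x]) x := by
    rw [hasFDerivAt_pi]
    intro i
    fin_cases i
    · exact hasFDerivAt_coord 0 x
    · exact hasFDerivAt_coord 1 x
    · exact (hasFDerivAt_diagQuadratic c d x).differentiableAt.hasFDerivAt
  rw [tangent, h.fderiv]
  ext k
  fin_cases k <;> simp [fderiv_diagQuadratic]

/-- The Hessian is independent of the point and of the level `d`, so its convergence only involves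
the coefficients. -/
lemma fderiv_tangent_diagQuadratic (c : Fin 2 → ℝ) (d : ℝ) (α β : Fin 2) (x : Plane) :
    fderiv ℝ (tangent (graphMap (diagQuadratic c d)) β) x (Pi.single α 1) =
      ![0, 0, 2 * c β * (Pi.single α 1 : Plane) β] := by
  have h : HasFDerivAt (tangent (graphMap (diagQuadratic c d)) β)
      (ContinuousLinearMap.pi ![0, 0,
        (2 * c β) • ContinuousLinearMap.proj (R := ℝ) (φ := fun _ : Fin 2 => ℝ) β]) x := by
    rw [tangent_diagQuadratic, hasFDerivAt_pi]
    intro i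
    fin_cases i
    · exact hasFDerivAt_const _ x
    · exact hasFDerivAt_const _ x
    · exact (hasFDerivAt_coord β x).const_mul (2 * c β)
  rw [h.fderiv]
  ext k
  fin_cases k <;> simp

lemma graphConormal_diagQuadratic (c : Fin 2 → ℝ) (d : ℝ) (x : Plane) :
    graphConormal (diagQuadratic c d) x = ![-(2 * c 0 * x 0), -(2 * c 1 * x 1), 1] := by
  simp only [graphConormal, fderiv_diagQuadratic]

lemma paraboloid_eq_diagQuadratic (φ : ℝ → ℝ) (A : Matrix (Fin 3) (Fin 3) ℝ) (s t : ℝ) :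
    paraboloid φ A s t = diagQuadratic
      ![deriv φ 0 * (bCoeff A 0 - 1 + s), deriv φ 0 * (bCoeff A 1 - 1 + s)] (t ^ 2) := by
  funext x
  simp [paraboloid, diagQuadratic]
  ring

/-! ### Limits of the geometric quantities -/

section Limits

variable {ι : Type*} {l : Filter ι}

lemma tendsto_matrix_inv {n : ℕ} {A : ι → Matrix (Fin n) (Fin n) ℝ}
    {A₀ : Matrix (Fin n) (Fin n) ℝ} (hA : Tendsto A l (𝓝 A₀)) (h : A₀.det ≠ 0) :
    Tendsto (fun y => (A y)⁻¹) l (𝓝 A₀⁻¹) := by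
  simp only [Matrix.inv_def, Ring.inverse_eq_inv']
  have hdet : Tendsto (fun y => (A y).det) l (𝓝 A₀.det) :=
    ((continuous_id.matrix_det).tendsto A₀).comp hA
  have hadj : Tendsto (fun y => (A y).adjugate) l (𝓝 A₀.adjugate) :=
    ((continuous_id.matrix_adjugate).tendsto A₀).comp hA
  exact (hdet.inv₀ h).smul hadj

lemma tendsto_matrix_entry {m n : ℕ} {A : ι → Matrix (Fin m) (Fin n) ℝ}
    {A₀ : Matrix (Fin m) (Fin n) ℝ} (hA : Tendsto A l (𝓝 A₀)) (i : Fin m) (j : Fin n) :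
    Tendsto (fun y => A y i j) l (𝓝 (A₀ i j)) :=
  tendsto_pi_nhds.1 (tendsto_pi_nhds.1 hA i) j

lemma tendsto_mulVec {A : ι → Matrix (Fin 3) (Fin 3) ℝ} {A₀ : Matrix (Fin 3) (Fin 3) ℝ}
    {v : ι → Space} {v₀ : Space} (hA : Tendsto A l (𝓝 A₀)) (hv : Tendsto v l (𝓝 v₀)) :
    Tendsto (fun y => A y *ᵥ v y) l (𝓝 (A₀ *ᵥ v₀)) :=
  ((continuous_fst.matrix_mulVec continuous_snd).tendsto (A₀, v₀)).comp (hA.prodMk_nhds hv)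

lemma tendsto_dotProduct {v w : ι → Space} {v₀ w₀ : Space}
    (hv : Tendsto v l (𝓝 v₀)) (hw : Tendsto w l (𝓝 w₀)) :
    Tendsto (fun y => v y ⬝ᵥ w y) l (𝓝 (v₀ ⬝ᵥ w₀)) :=
  ((continuous_fst.dotProduct continuous_snd).tendsto (v₀, w₀)).comp (hv.prodMk_nhds hw)

lemma tendsto_gInner {A : ι → Matrix (Fin 3) (Fin 3) ℝ} {A₀ : Matrix (Fin 3) (Fin 3) ℝ}
    {v w : ι → Space} {v₀ w₀ : Space} (hA : Tendsto A l (𝓝 A₀))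
    (hv : Tendsto v l (𝓝 v₀)) (hw : Tendsto w l (𝓝 w₀)) :
    Tendsto (fun y => gInner (A y) (v y) (w y)) l (𝓝 (gInner A₀ v₀ w₀)) :=
  tendsto_dotProduct hv (tendsto_mulVec hA hw)

lemma tendsto_unitNormal {A : ι → Matrix (Fin 3) (Fin 3) ℝ} {A₀ : Matrix (Fin 3) (Fin 3) ℝ}
    {ν : ι → Space} {ν₀ : Space} (hA : Tendsto A l (𝓝 A₀)) (hA₀ : A₀.PosDef)
    (hν : Tendsto ν l (𝓝 ν₀)) (hν₀ : ν₀ ≠ 0) :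
    Tendsto (fun y => unitNormal (A y) (ν y)) l (𝓝 (unitNormal A₀ ν₀)) := by
  have hi := tendsto_matrix_inv hA hA₀.det_pos.ne'
  have hm := tendsto_mulVec hi hν
  have hpos : 0 < ν₀ ⬝ᵥ (A₀⁻¹ *ᵥ ν₀) := by
    simpa using hA₀.inv.dotProduct_mulVec_pos hν₀
  exact (((tendsto_dotProduct hν hm).sqrt).inv₀ (Real.sqrt_pos.2 hpos).ne').smul hm

/-- The mean curvatures of a family of quadratic graphs converge if the gradients tend to zero, the
Hessians converge, and the metric and its first derivatives converge. -/
lemma tendsto_meanCurvature_diagQuadratic {g : MetricField} {A : Matrix (Fin 3) (Fin 3) ℝ}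
    (hA : A.PosDef) {D : Fin 3 → Fin 3 → Fin 3 → ℝ} {c : ι → Fin 2 → ℝ} {c₀ : Fin 2 → ℝ}
    {d : ι → ℝ} {x : ι → Plane} (hc : ∀ α, Tendsto (fun y => c y α) l (𝓝 (c₀ α)))
    (hx : ∀ α, Tendsto (fun y => x y α) l (𝓝 0))
    (hg : Tendsto (fun y => g (graphMap (diagQuadratic (c y) (d y)) (x y))) l (𝓝 A))
    (hD : ∀ k i j, Tendsto
      (fun y => dMetric g (graphMap (diagQuadratic (c y) (d y)) (x y)) k i j) l (𝓝 (D k i j))) :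
    ∃ H₀ : ℝ, Tendsto (fun y => graphMeanCurvature g (diagQuadratic (c y) (d y)) (x y)) l
      (𝓝 H₀) := by
  have hgrad : ∀ α, Tendsto (fun y => 2 * c y α * x y α) l (𝓝 0) := fun α => by
    simpa using ((hc α).const_mul 2).mul (hx α)
  set T : Fin 2 → Space := fun α => ![(Pi.single α 1 : Plane) 0, (Pi.single α 1 : Plane) 1, 0]
  have hT : ∀ α, Tendsto
      (fun y => tangent (graphMap (diagQuadratic (c y) (d y))) α (x y)) l (𝓝 (T α)) := fun α => by
    simp only [tangent_diagQuadratic, T]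
    rw [tendsto_pi_nhds]
    intro k
    fin_cases k
    · exact tendsto_const_nhds
    · exact tendsto_const_nhds
    · exact hgrad α
  have hGinv := tendsto_matrix_inv hg hA.det_pos.ne'
  have hΓ : ∀ i j k, ∃ Γ₀, Tendsto
      (fun y => christoffel g (graphMap (diagQuadratic (c y) (d y)) (x y)) i j k) l (𝓝 Γ₀) :=
    fun i j k => ⟨_, (tendsto_finsetSum _ fun m _ => (tendsto_matrix_entry hGinv k m).mul
      (((hD i j m).add (hD j i m)).sub (hD m i j))).const_mul _⟩
  choose Γ hΓ using hΓ
  have hcov : ∀ α β, ∃ V, Tendsto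
      (fun y => covDeriv g (graphMap (diagQuadratic (c y) (d y))) α β (x y)) l (𝓝 V) := by
    intro α β
    have h : ∀ k, ∃ V, Tendsto
        (fun y => covDeriv g (graphMap (diagQuadratic (c y) (d y))) α β (x y) k) l (𝓝 V) := by
      intro k
      have h2 : Tendsto (fun y => fderiv ℝ (tangent (graphMap (diagQuadratic (c y) (d y))) β) (x y)
          (Pi.single α 1) k) l (𝓝 ((![0, 0, 2 * c₀ β * (Pi.single α 1 : Plane) β] : Space) k)) := by
        simp only [fderiv_tangent_diagQuadratic]
        fin_cases k
        · exact tendsto_const_nhds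
        · exact tendsto_const_nhds
        · exact ((hc β).const_mul 2).mul_const _
      exact ⟨_, h2.add (tendsto_finsetSum _ fun i _ => tendsto_finsetSum _ fun j _ =>
        ((hΓ i j k).mul (tendsto_pi_nhds.1 (hT α) i)).mul (tendsto_pi_nhds.1 (hT β) j))⟩
    choose V hV using h
    exact ⟨V, tendsto_pi_nhds.2 hV⟩
  choose V hV using hcov
  have hN : Tendsto (fun y => unitNormal (g (graphMap (diagQuadratic (c y) (d y)) (x y)))
      (graphConormal (diagQuadratic (c y) (d y)) (x y))) l (𝓝 (unitNormal A ![0, 0, 1])) := by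
    refine tendsto_unitNormal hg hA ?_ fun h => by simpa using congrFun h 2
    simp only [graphConormal_diagQuadratic]
    rw [tendsto_pi_nhds]
    intro k
    fin_cases k
    · simpa using (hgrad 0).neg
    · simpa using (hgrad 1).neg
    · exact tendsto_const_nhds
  have hF : Tendsto (fun y => firstForm g (graphMap (diagQuadratic (c y) (d y))) (x y)) l
      (𝓝 (Matrix.of fun α β => gInner A (T α) (T β))) :=
    tendsto_pi_nhds.2 fun α => tendsto_pi_nhds.2 fun β => tendsto_gInner hg (hT α) (hT β)
  have hFdet : (Matrix.of fun α β => gInner A (T α) (T β)).det ≠ 0 := by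
    -- The limiting tangent vectors are the horizontal basis vectors, so the limiting first form is
    -- a principal block of `A`, hence positive definite.
    have he : (Matrix.of fun α β => gInner A (T α) (T β)) =
        A.submatrix (Fin.castSucc : Fin 2 → Fin 3) Fin.castSucc := by
      ext α β
      fin_cases α <;> fin_cases β <;>
        simp [T, gInner, Matrix.mulVec, dotProduct, Fin.sum_univ_three]
    rw [he]
    exact (hA.submatrix (Fin.castSucc_injective 2)).det_pos.ne'
  have hFinv := tendsto_matrix_inv hF hFdet
  exact ⟨_, (tendsto_finsetSum _ fun α _ => tendsto_finsetSum _ fun β _ =>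
    (tendsto_matrix_entry hFinv α β).mul (tendsto_gInner hg (hV α β) hN)).neg⟩

end Limits

/-- The derivative of a function that is smooth on `S`, up to the boundary, has a limit along the
interior of `S` at every point of `S`. -/
lemma exists_tendsto_fderiv_interior {E : Type*} [NormedAddCommGroup E] [NormedSpace ℝ E]
    {f : E → ℝ} {S : Set E} {p : E} (hf : ContDiffWithinAt ℝ 1 f S p) (hp : p ∈ S) :
    ∃ D : E →L[ℝ] ℝ, Tendsto (fderiv ℝ f) (𝓝[interior S] p) (𝓝 D) := by
  have h1 : ContDiffWithinAt ℝ (0 + 1) f S p := by simpa using hf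
  obtain ⟨u, hu, -, f', hf', hc⟩ :=
    (contDiffWithinAt_succ_iff_hasFDerivWithinAt (by simp)).1 h1
  rw [Set.insert_eq_of_mem hp] at hu
  have hu' : u ∈ 𝓝[interior S] p := nhdsWithin_mono p interior_subset hu
  refine ⟨f' p, ?_⟩
  have hcu : Tendsto f' (𝓝[interior S] p) (𝓝 (f' p)) :=
    hc.continuousWithinAt.mono_left (nhdsWithin_le_iff.2 hu')
  refine hcu.congr' ?_
  obtain ⟨v, hv, hvo, hpv, hvu⟩ : ∃ v, v ∈ 𝓝 p ∧ IsOpen v ∧ p ∈ v ∧ v ∩ S ⊆ u := by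
    obtain ⟨v, hvo, hpv, hvu⟩ := mem_nhdsWithin.1 hu
    exact ⟨v, hvo.mem_nhds hpv, hvo, hpv, hvu⟩
  filter_upwards [mem_nhdsWithin_of_mem_nhds hv, self_mem_nhdsWithin] with q hqv hqS
  -- At an interior point of `S` the set `u` is a full neighbourhood, so the derivative within `u`
  -- is the ordinary one.
  have hq : u ∈ 𝓝 q := mem_of_superset
    ((hvo.inter isOpen_interior).mem_nhds ⟨hqv, hqS⟩)
    fun r hr => hvu ⟨hr.1, interior_subset hr.2⟩
  exact ((hf' q (mem_of_mem_nhds hq)).hasFDerivAt hq).fderiv.symm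

/-! ### Contact angles -/

/-- Raising indices is an isometry: the angle between normals is the angle between conormals in the
dual metric `A⁻¹`. -/
lemma gInner_unitNormal {A : Matrix (Fin 3) (Fin 3) ℝ} (hA : A.det ≠ 0) (μ ν : Space) :
    gInner A (unitNormal A μ) (unitNormal A ν) =
      (√(μ ⬝ᵥ (A⁻¹ *ᵥ μ)))⁻¹ * (√(ν ⬝ᵥ (A⁻¹ *ᵥ ν)))⁻¹ * ((A⁻¹ *ᵥ μ) ⬝ᵥ ν) := by
  have h : A *ᵥ (A⁻¹ *ᵥ ν) = ν := by
    rw [Matrix.mulVec_mulVec, Matrix.mul_nonsing_inv _ (isUnit_iff_ne_zero.2 hA), Matrix.one_mulVec]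
  simp only [gInner, unitNormal, Matrix.mulVec_smul, smul_dotProduct, dotProduct_smul, h,
    smul_eq_mul]
  ring

/-- The angle determined by `μ` and `ν` for a metric exceeds the Euclidean angle between `μ` and
the vertical direction if the squared cosine of the former is less than that of the latter. -/
lemma normalAngle_one_lt_normalAngle {A : Matrix (Fin 3) (Fin 3) ℝ} (hA : A.PosDef)
    {m₀ m₁ : ℝ} {ν : Space} (hν : ν ≠ 0)
    (h : (1 + m₀ ^ 2 + m₁ ^ 2) * ((A⁻¹ *ᵥ ![m₀, m₁, 1]) ⬝ᵥ ν) ^ 2 <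
      (![m₀, m₁, 1] ⬝ᵥ (A⁻¹ *ᵥ ![m₀, m₁, 1])) * (ν ⬝ᵥ (A⁻¹ *ᵥ ν))) :
    normalAngle 1 ![m₀, m₁, 1] ![0, 0, 1] < normalAngle A ![m₀, m₁, 1] ν := by
  unfold normalAngle
  rw [gInner_unitNormal hA.det_pos.ne', gInner_unitNormal (by simp)]
  have hμ : (![m₀, m₁, 1] : Space) ≠ 0 := fun h => by simpa using congrFun h 2
  have hp : 0 < (![m₀, m₁, 1] : Space) ⬝ᵥ (A⁻¹ *ᵥ ![m₀, m₁, 1]) := by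
    simpa using hA.inv.dotProduct_mulVec_pos hμ
  have hq : 0 < ν ⬝ᵥ (A⁻¹ *ᵥ ν) := by simpa using hA.inv.dotProduct_mulVec_pos hν
  set p := (![m₀, m₁, 1] : Space) ⬝ᵥ (A⁻¹ *ᵥ ![m₀, m₁, 1])
  set q := ν ⬝ᵥ (A⁻¹ *ᵥ ν)
  set r := (A⁻¹ *ᵥ ![m₀, m₁, 1]) ⬝ᵥ ν
  have hn : 0 < 1 + m₀ ^ 2 + m₁ ^ 2 := by positivity
  have he : (√((![m₀, m₁, 1] : Space) ⬝ᵥ ((1 : Matrix (Fin 3) (Fin 3) ℝ)⁻¹ *ᵥ ![m₀, m₁, 1])))⁻¹ *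
      (√((![0, 0, 1] : Space) ⬝ᵥ ((1 : Matrix (Fin 3) (Fin 3) ℝ)⁻¹ *ᵥ ![0, 0, 1])))⁻¹ *
      (((1 : Matrix (Fin 3) (Fin 3) ℝ)⁻¹ *ᵥ ![m₀, m₁, 1]) ⬝ᵥ ![0, 0, 1]) =
      (√(1 + m₀ ^ 2 + m₁ ^ 2))⁻¹ := by
    have h1 : m₀ * m₀ + (m₁ * m₁ + 1) = 1 + m₀ ^ 2 + m₁ ^ 2 := by ring
    simp [h1]
  rw [he]
  have hc : 0 < (√(1 + m₀ ^ 2 + m₁ ^ 2))⁻¹ := inv_pos.2 (Real.sqrt_pos.2 hn)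
  have hc1 : (√(1 + m₀ ^ 2 + m₁ ^ 2))⁻¹ ≤ 1 :=
    inv_le_one_of_one_le₀ (Real.one_le_sqrt.2 (by nlinarith [sq_nonneg m₀, sq_nonneg m₁]))
  -- Comparing squares suffices whatever the sign of `r`, since the Euclidean cosine is positive.
  have hsq : ((√p)⁻¹ * (√q)⁻¹ * r) ^ 2 < ((√(1 + m₀ ^ 2 + m₁ ^ 2))⁻¹) ^ 2 := by
    rw [mul_pow, mul_pow, inv_pow, inv_pow, inv_pow, Real.sq_sqrt hp.le, Real.sq_sqrt hq.le,
      Real.sq_sqrt hn.le, ← mul_inv, inv_mul_eq_div, ← one_div,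
      div_lt_div_iff₀ (mul_pos hp hq) hn]
    linarith
  have habs := abs_lt_of_sq_lt_sq hsq hc.le
  exact Real.arccos_lt_arccos (by linarith [(abs_lt.1 habs).1]) (abs_lt.1 habs).2 hc1

/-- The minors of the inverse matrix that determine the contact angle at the pole. -/
lemma inv_minors {A : Matrix (Fin 3) (Fin 3) ℝ} (hA : A.PosDef) (h01 : A 0 1 = 0) :
    (A⁻¹ 2 2 * A⁻¹ 0 0 - A⁻¹ 0 2 ^ 2) * A 0 0 = A⁻¹ 2 2 ∧
    (A⁻¹ 2 2 * A⁻¹ 1 1 - A⁻¹ 1 2 ^ 2) * A 1 1 = A⁻¹ 2 2 ∧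
    A⁻¹ 2 2 * A⁻¹ 0 1 - A⁻¹ 0 2 * A⁻¹ 1 2 = 0 := by
  have hs : ∀ i j, A i j = A j i := fun i j => by simpa using (hA.isHermitian.apply i j).symm
  have h10 : A 1 0 = 0 := (hs 1 0).trans h01
  have hdet := hA.det_pos.ne'
  have hi : A⁻¹ = A.det⁻¹ • A.adjugate := by rw [Matrix.inv_def, Ring.inverse_eq_inv']
  have hd := Matrix.det_fin_three A
  rw [h01, h10, hs 2 0, hs 2 1] at hd
  -- By Jacobi, a 2 × 2 minor of `A⁻¹` is, up to sign, an entry of `A` over `A.det`; with `A 0 1 =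
  -- 0` also `A⁻¹ 2 2 = A 0 0 * A 1 1 / A.det`.
  rw [hi, Matrix.adjugate_fin_three]
  simp only [Matrix.smul_apply, Matrix.of_apply, Matrix.cons_val, smul_eq_mul, h01, h10, hs 2 0,
    hs 2 1]
  refine ⟨?_, ?_, ?_⟩ <;> field_simp <;> rw [hd] <;> ring

lemma bCoeff_pos {A : Matrix (Fin 3) (Fin 3) ℝ} (hA : A.PosDef) (i : Fin 3) : 0 < bCoeff A i :=
  Real.sqrt_pos.2 (mul_pos hA.diag_pos hA.inv.diag_pos)

lemma sq_bCoeff {A : Matrix (Fin 3) (Fin 3) ℝ} (hA : A.PosDef) (i : Fin 3) :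
    bCoeff A i ^ 2 = A i i * A⁻¹ 2 2 :=
  Real.sq_sqrt (mul_pos hA.diag_pos hA.inv.diag_pos).le

/-- A planar quadratic form with convergent coefficients is eventually positive if the limit is
diagonal with positive entries. -/
lemma eventually_quadraticForm_pos {ι : Type*} {l : Filter ι} {a b c : ι → ℝ} {a₀ c₀ : ℝ}
    (ha : Tendsto a l (𝓝 a₀)) (hb : Tendsto b l (𝓝 0)) (hc : Tendsto c l (𝓝 c₀))
    (ha₀ : 0 < a₀) (hc₀ : 0 < c₀) :
    ∀ᶠ y in l, ∀ x : Plane, x ≠ 0 → 0 < a y * x 0 ^ 2 + 2 * b y * (x 0 * x 1) + c y * x 1 ^ 2 := by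
  -- Eventually both diagonal coefficients exceed `m` while `|b y| ≤ m`, so `2|x₀x₁| ≤ x₀² + x₁²`
  -- absorbs the cross term.
  set m := min a₀ c₀ / 2
  have hm : 0 < m := half_pos (lt_min ha₀ hc₀)
  have hma : m < a₀ := (half_lt_self (lt_min ha₀ hc₀)).trans_le (min_le_left _ _)
  have hmc : m < c₀ := (half_lt_self (lt_min ha₀ hc₀)).trans_le (min_le_right _ _)
  filter_upwards [ha.eventually_const_lt hma, hc.eventually_const_lt hmc,
    hb.eventually_const_lt (neg_lt_zero.2 hm), hb.eventually_lt_const hm] with y h1 h2 h3 h4 x hx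
  have hx2 : 0 < x 0 ^ 2 + x 1 ^ 2 := by
    by_contra! h
    apply hx
    have h0 : x 0 = 0 := by nlinarith [sq_nonneg (x 0), sq_nonneg (x 1)]
    have h1 : x 1 = 0 := by nlinarith [sq_nonneg (x 0), sq_nonneg (x 1)]
    ext i
    fin_cases i
    · exact h0
    · exact h1
  have hb' : |b y| ≤ m := (abs_lt.2 ⟨h3, h4⟩).le
  have hxx : 2 * |x 0 * x 1| ≤ x 0 ^ 2 + x 1 ^ 2 := by
    rw [abs_mul, ← sq_abs (x 0), ← sq_abs (x 1)]
    nlinarith [sq_nonneg (|x 0| - |x 1|)]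
  have hprod : |b y * (x 0 * x 1)| ≤ m * |x 0 * x 1| := by
    rw [abs_mul]
    exact mul_le_mul_of_nonneg_right hb' (abs_nonneg _)
  have hlow := (abs_le.1 hprod).1
  rcases (sq_nonneg (x 0)).eq_or_lt with h0 | h0
  · nlinarith [mul_pos (sub_pos.2 h2) (by linarith : 0 < x 1 ^ 2)]
  · nlinarith [mul_pos (sub_pos.2 h1) h0, mul_nonneg (sub_pos.2 h2).le (sq_nonneg (x 1))]

/-! ### The boundary near the pole -/

lemma sqNorm_zero : sqNorm 0 = 0 := by simp [sqNorm]

lemma hasFDerivAt_sqNorm (x : Plane) :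
    HasFDerivAt sqNorm
      ((2 * x 0) • ContinuousLinearMap.proj (R := ℝ) (φ := fun _ : Fin 2 => ℝ) 0
        + (2 * x 1) • ContinuousLinearMap.proj (R := ℝ) (φ := fun _ : Fin 2 => ℝ) 1) x := by
  have h := ((hasFDerivAt_coord 0 x).pow 2).add ((hasFDerivAt_coord 1 x).pow 2)
  refine h.congr_fderiv ?_
  ext v
  simp

lemma continuous_sqNorm : Continuous sqNorm := by unfold sqNorm; fun_prop

lemma tendsto_sqNorm_zero : Tendsto sqNorm (𝓝 0) (𝓝 0) := by
  simpa [sqNorm_zero] using continuous_sqNorm.tendsto 0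

lemma graphConormal_boundaryHeight {φ : ℝ → ℝ} {x : Plane}
    (h : DifferentiableAt ℝ φ (sqNorm x)) :
    graphConormal (boundaryHeight φ) x =
      ![2 * deriv φ (sqNorm x) * x 0, 2 * deriv φ (sqNorm x) * x 1, 1] := by
  have h1 : HasFDerivAt (boundaryHeight φ) (-(deriv φ (sqNorm x) •
      ((2 * x 0) • ContinuousLinearMap.proj (R := ℝ) (φ := fun _ : Fin 2 => ℝ) 0
        + (2 * x 1) • ContinuousLinearMap.proj (R := ℝ) (φ := fun _ : Fin 2 => ℝ) 1))) x :=
    (h.hasDerivAt.comp_hasFDerivAt x (hasFDerivAt_sqNorm x)).neg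
  rw [graphConormal, h1.fderiv]
  ext i
  fin_cases i <;> simp <;> ring

/-- Smoothness at the single point 0 spreads to a neighbourhood only order by order; order one is
all that is needed. -/
lemma eventually_contDiffAt_one {φ : ℝ → ℝ} (hφ : ContDiffAt ℝ ∞ φ 0) :
    ∀ᶠ r in 𝓝 0, ContDiffAt ℝ 1 φ r :=
  (hφ.of_le (by simp)).eventually (by simp)

lemma continuousAt_deriv {φ : ℝ → ℝ} (hφ : ContDiffAt ℝ ∞ φ 0) : ContinuousAt (deriv φ) 0 := by
  have h : ContinuousAt (fderiv ℝ φ) 0 :=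
    ((hφ.of_le (by simp : (1 : WithTop ℕ∞) ≤ ∞)).fderiv_right (m := 0) (by simp)).continuousAt
  have h1 := h.clm_apply (continuousAt_const (y := (1 : ℝ)))
  simpa [Function.comp_def, fderiv_apply_one_eq_deriv] using h1

lemma eventually_continuousAt_boundaryHeight {φ : ℝ → ℝ} (hφ : ContDiffAt ℝ ∞ φ 0) :
    ∀ᶠ x in 𝓝 0, ContinuousAt (boundaryHeight φ) x :=
  (tendsto_sqNorm_zero.eventually (eventually_contDiffAt_one hφ)).mono fun _ hx =>
    (ContinuousAt.comp hx.continuousAt continuous_sqNorm.continuousAt).neg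

lemma boundaryHeight_zero {φ : ℝ → ℝ} (hφ_zero : φ 0 = 0) : boundaryHeight φ 0 = 0 := by
  simp [boundaryHeight, sqNorm_zero, hφ_zero]

lemma zero_mem_localBody {φ : ℝ → ℝ} (hφ_zero : φ 0 = 0) {U : Set Space}
    (hU_zero : (0 : Space) ∈ U) : (0 : Space) ∈ localBody φ U := by
  refine ⟨hU_zero, ?_⟩
  have h : (![(0 : Space) 0, (0 : Space) 1] : Plane) = 0 := by ext i; fin_cases i <;> rfl
  rw [h, boundaryHeight_zero hφ_zero]
  rfl

lemma graphMap_mem_localBody {φ : ℝ → ℝ} {U : Set Space} {f : Plane → ℝ} {x : Plane} :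
    graphMap f x ∈ localBody φ U ↔ graphMap f x ∈ U ∧ f x ≤ boundaryHeight φ x := by
  have h : (![graphMap f x 0, graphMap f x 1] : Plane) = x := by
    ext i; fin_cases i <;> rfl
  rw [localBody, Set.mem_ofPred_eq, h]
  rfl

lemma tendsto_graphMap {ι : Type*} {l : Filter ι} {f : ι → Plane → ℝ} {x : ι → Plane}
    (hx : Tendsto x l (𝓝 0)) (hf : Tendsto (fun y => f y (x y)) l (𝓝 0)) :
    Tendsto (fun y => graphMap (f y) (x y)) l (𝓝 0) := by
  rw [tendsto_pi_nhds]
  intro i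
  fin_cases i
  · exact tendsto_pi_nhds.1 hx 0
  · exact tendsto_pi_nhds.1 hx 1
  · exact hf

/-- For `s > 0` the contact angle exceeds the model angle near the pole. -/
lemma eventually_modelAngle_lt_contactAngle {φ : ℝ → ℝ} (hφ : ContDiffAt ℝ ∞ φ 0)
    (hφ_zero : φ 0 = 0) (hφ_deriv : 0 < deriv φ 0) {U : Set Space} (hU : IsOpen U)
    (hU_zero : (0 : Space) ∈ U) {g : MetricField} (hg : ContinuousOn g (localBody φ U))
    (hg_pos : ∀ p ∈ localBody φ U, (g p).PosDef) (hg_axes : g 0 0 1 = 0) {s : ℝ} (hs : 0 < s) :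
    ∀ᶠ x in 𝓝 (0 : Plane), x ≠ 0 → ∀ t, modelAngle φ x < contactAngle φ g s t x := by
  have h0 := zero_mem_localBody hφ_zero hU_zero
  have hA := hg_pos 0 h0
  have hF : Tendsto (graphMap (boundaryHeight φ)) (𝓝 0) (𝓝 0) := by
    refine tendsto_graphMap (f := fun _ => boundaryHeight φ) tendsto_id ?_
    have h := (eventually_continuousAt_boundaryHeight hφ).self_of_nhds.tendsto
    rwa [boundaryHeight_zero hφ_zero] at h
  have hbody : ∀ᶠ x in 𝓝 (0 : Plane), graphMap (boundaryHeight φ) x ∈ localBody φ U :=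
    (hF.eventually (hU.mem_nhds hU_zero)).mono fun x hx => graphMap_mem_localBody.2 ⟨hx, le_rfl⟩
  have hgt : Tendsto (fun x => g (graphMap (boundaryHeight φ) x)) (𝓝 0) (𝓝 (g 0)) :=
    (hg 0 h0).tendsto.comp (tendsto_nhdsWithin_iff.2 ⟨hF, hbody⟩)
  have hB := tendsto_matrix_inv hgt hA.det_pos.ne'
  have hdφ : Tendsto (fun x => deriv φ (sqNorm x)) (𝓝 0) (𝓝 (deriv φ 0)) :=
    (continuousAt_deriv hφ).tendsto.comp tendsto_sqNorm_zero
  have hx : ∀ i, Tendsto (fun x : Plane => x i) (𝓝 0) (𝓝 0) := fun i =>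
    (continuous_apply i).tendsto 0
  obtain ⟨hm0, hm1, hm01⟩ := inv_minors hA hg_axes
  have hb0 := bCoeff_pos hA 0
  have hb1 := bCoeff_pos hA 1
  have hsq0 := sq_bCoeff hA 0
  have hsq1 := sq_bCoeff hA 1
  have ha0 : 0 < g 0 0 0 := hA.diag_pos
  have ha1 : 0 < g 0 1 1 := hA.diag_pos
  have hi2 : 0 < (g 0)⁻¹ 2 2 := hA.inv.diag_pos
  set k := deriv φ 0
  set B : Plane → Matrix (Fin 3) (Fin 3) ℝ := fun x => (g (graphMap (boundaryHeight φ) x))⁻¹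
  set c : Fin 2 → ℝ := ![k * (bCoeff (g 0) 0 - 1 + s), k * (bCoeff (g 0) 1 - 1 + s)]
  set μ : Plane → Space := fun x =>
    ![2 * deriv φ (sqNorm x) * x 0, 2 * deriv φ (sqNorm x) * x 1, 1]
  set ν : Plane → Space := fun x => ![-(2 * c 0 * x 0), -(2 * c 1 * x 1), 1]
  -- These are the coefficients of the horizontal covector `μ - ν = (W₀ x₀, W₁ x₁, 0)`.
  set W : Fin 2 → Plane → ℝ := fun α x => 2 * deriv φ (sqNorm x) + 2 * c α
  have hμ : Tendsto μ (𝓝 0) (𝓝 ![0, 0, 1]) := by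
    rw [tendsto_pi_nhds]
    intro i
    fin_cases i
    · simpa [μ] using (hdφ.const_mul 2).mul (hx 0)
    · simpa [μ] using (hdφ.const_mul 2).mul (hx 1)
    · exact tendsto_const_nhds
  have hν : Tendsto ν (𝓝 0) (𝓝 ![0, 0, 1]) := by
    rw [tendsto_pi_nhds]
    intro i
    fin_cases i
    · simpa [ν] using ((hx 0).const_mul (2 * c 0)).neg
    · simpa [ν] using ((hx 1).const_mul (2 * c 1)).neg
    · exact tendsto_const_nhds
  have hW0 : Tendsto (W 0) (𝓝 0) (𝓝 (2 * k * (bCoeff (g 0) 0 + s))) := by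
    convert (hdφ.const_mul 2).add_const (2 * c 0) using 2
    simp [c]; ring
  have hW1 : Tendsto (W 1) (𝓝 0) (𝓝 (2 * k * (bCoeff (g 0) 1 + s))) := by
    convert (hdφ.const_mul 2).add_const (2 * c 1) using 2
    simp [c]; ring
  have hBν := tendsto_mulVec hB hν
  have hBμ := tendsto_mulVec hB hμ
  have hνν := tendsto_dotProduct hν hBν
  have hμν := tendsto_dotProduct hBμ hν
  have hBe : (g 0)⁻¹ *ᵥ (![0, 0, 1] : Space) = ![(g 0)⁻¹ 0 2, (g 0)⁻¹ 1 2, (g 0)⁻¹ 2 2] := by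
    ext i
    fin_cases i <;> simp [Matrix.mulVec, dotProduct, Fin.sum_univ_three]
  have hee : (![0, 0, 1] : Space) ⬝ᵥ ![(g 0)⁻¹ 0 2, (g 0)⁻¹ 1 2, (g 0)⁻¹ 2 2] = (g 0)⁻¹ 2 2 := by
    simp [dotProduct, Fin.sum_univ_three]
  have hee' : ![(g 0)⁻¹ 0 2, (g 0)⁻¹ 1 2, (g 0)⁻¹ 2 2] ⬝ᵥ (![0, 0, 1] : Space) = (g 0)⁻¹ 2 2 := by
    simp [dotProduct, Fin.sum_univ_three]
  rw [hBe] at hBν hBμ hνν hμν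
  rw [hee] at hνν
  rw [hee'] at hμν
  have hBν' : ∀ i, Tendsto (fun x => (B x *ᵥ ν x) i) (𝓝 0) (𝓝 ((g 0)⁻¹ i 2)) := by
    intro i
    have := tendsto_pi_nhds.1 hBν i
    fin_cases i <;> exact this
  -- The form is the Gram determinant of `μ - ν` and `ν` for `B`, minus `(2φ')² |x|² ⟨μ, ν⟩²`, the
  -- excess caused by the factor `1 + m₀² + m₁²`.
  have key := eventually_quadraticForm_pos
    (((((hνν.mul (tendsto_matrix_entry hB 0 0)).sub ((hBν' 0).pow 2)).mul (hW0.pow 2))).sub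
      (((hdφ.const_mul 2).pow 2).mul (hμν.pow 2)))
    (b := fun x => ((ν x ⬝ᵥ (B x *ᵥ ν x)) * B x 0 1 - (B x *ᵥ ν x) 0 * (B x *ᵥ ν x) 1) *
      (W 0 x * W 1 x))
    (by
      have h := ((hνν.mul (tendsto_matrix_entry hB 0 1)).sub ((hBν' 0).mul (hBν' 1))).mul
        (hW0.mul hW1)
      rwa [hm01, zero_mul] at h)
    (((((hνν.mul (tendsto_matrix_entry hB 1 1)).sub ((hBν' 1).pow 2)).mul (hW1.pow 2))).sub
      (((hdφ.const_mul 2).pow 2).mul (hμν.pow 2)))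
    (by
      -- Strictness comes from `s > 0` alone: at `s = 0` this limiting coefficient vanishes.
      have hb : bCoeff (g 0) 0 ^ 2 < (bCoeff (g 0) 0 + s) ^ 2 := by nlinarith
      rw [hsq0] at hb
      rw [eq_div_of_mul_eq ha0.ne' hm0, sub_pos]
      calc (2 * k) ^ 2 * (g 0)⁻¹ 2 2 ^ 2
          = (g 0)⁻¹ 2 2 / g 0 0 0 * (2 * k) ^ 2 * (g 0 0 0 * (g 0)⁻¹ 2 2) := by field_simp
        _ < (g 0)⁻¹ 2 2 / g 0 0 0 * (2 * k) ^ 2 * (bCoeff (g 0) 0 + s) ^ 2 := by gcongr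
        _ = _ := by ring)
    (by
      have hb : bCoeff (g 0) 1 ^ 2 < (bCoeff (g 0) 1 + s) ^ 2 := by nlinarith
      rw [hsq1] at hb
      rw [eq_div_of_mul_eq ha1.ne' hm1, sub_pos]
      calc (2 * k) ^ 2 * (g 0)⁻¹ 2 2 ^ 2
          = (g 0)⁻¹ 2 2 / g 0 1 1 * (2 * k) ^ 2 * (g 0 1 1 * (g 0)⁻¹ 2 2) := by field_simp
        _ < (g 0)⁻¹ 2 2 / g 0 1 1 * (2 * k) ^ 2 * (bCoeff (g 0) 1 + s) ^ 2 := by gcongr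
        _ = _ := by ring)
  filter_upwards [key, hbody,
    tendsto_sqNorm_zero.eventually (eventually_contDiffAt_one hφ)] with x hkey hxb hxφ hx0 t
  have hAx := hg_pos _ hxb
  have hsym : ∀ i j, B x i j = B x j i := fun i j => by
    simpa using (hAx.inv.isHermitian.apply i j).symm
  rw [modelAngle, contactAngle, paraboloid_eq_diagQuadratic, graphConormal_diagQuadratic,
    graphConormal_boundaryHeight (hxφ.differentiableAt (by simp))]
  refine normalAngle_one_lt_normalAngle hAx (fun h => by simpa using congrFun h 2) ?_
  have hpos := hkey x hx0
  change (1 + (2 * deriv φ (sqNorm x) * x 0) ^ 2 + (2 * deriv φ (sqNorm x) * x 1) ^ 2) *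
    ((B x *ᵥ μ x) ⬝ᵥ ν x) ^ 2 < (μ x ⬝ᵥ (B x *ᵥ μ x)) * (ν x ⬝ᵥ (B x *ᵥ ν x))
  -- A Gram determinant is unchanged when `μ` is replaced by `μ - ν`.
  have hid : (μ x ⬝ᵥ (B x *ᵥ μ x)) * (ν x ⬝ᵥ (B x *ᵥ ν x)) - ((B x *ᵥ μ x) ⬝ᵥ ν x) ^ 2 =
      ((ν x ⬝ᵥ (B x *ᵥ ν x)) * B x 0 0 - (B x *ᵥ ν x) 0 ^ 2) * W 0 x ^ 2 * x 0 ^ 2 +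
      2 * (((ν x ⬝ᵥ (B x *ᵥ ν x)) * B x 0 1 - (B x *ᵥ ν x) 0 * (B x *ᵥ ν x) 1) *
        (W 0 x * W 1 x)) * (x 0 * x 1) +
      ((ν x ⬝ᵥ (B x *ᵥ ν x)) * B x 1 1 - (B x *ᵥ ν x) 1 ^ 2) * W 1 x ^ 2 * x 1 ^ 2 := by
    simp only [Matrix.mulVec, dotProduct, Fin.sum_univ_three, μ, ν, W, Matrix.cons_val,
      hsym 1 0, hsym 2 0, hsym 2 1]
    ring
  nlinarith [hid, hpos]

/-! ### The limit of the mean curvatures -/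

lemma tendsto_paraboloid (φ : ℝ → ℝ) (A : Matrix (Fin 3) (Fin 3) ℝ) :
    Tendsto (fun q : ℝ × ℝ × Plane => paraboloid φ A q.1 q.2.1 q.2.2) (𝓝 0) (𝓝 0) := by
  have h : Continuous fun q : ℝ × ℝ × Plane => paraboloid φ A q.1 q.2.1 q.2.2 := by
    unfold paraboloid
    fun_prop
  simpa [paraboloid] using h.tendsto 0

lemma tendsto_graphMap_paraboloid (φ : ℝ → ℝ) (A : Matrix (Fin 3) (Fin 3) ℝ) :
    Tendsto (fun q : ℝ × ℝ × Plane => graphMap (paraboloid φ A q.1 q.2.1) q.2.2) (𝓝 0) (𝓝 0) :=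
  tendsto_graphMap ((continuous_snd.comp continuous_snd).tendsto 0) (tendsto_paraboloid φ A)

/-- Points near the pole strictly below the boundary are interior points of the body. -/
lemma eventually_mem_interior_localBody {φ : ℝ → ℝ} (hφ : ContDiffAt ℝ ∞ φ 0) {U : Set Space}
    (hU : IsOpen U) (hU_zero : (0 : Space) ∈ U) :
    ∀ᶠ p in 𝓝 (0 : Space), p 2 < boundaryHeight φ ![p 0, p 1] → p ∈ interior (localBody φ U) := by
  have hc : Continuous fun p : Space => (![p 0, p 1] : Plane) :=
    continuous_pi fun i => by fin_cases i <;> exact continuous_apply _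
  have h0 : (![(0 : Space) 0, (0 : Space) 1] : Plane) = 0 := by ext i; fin_cases i <;> rfl
  have ht : Tendsto (fun p : Space => (![p 0, p 1] : Plane)) (𝓝 0) (𝓝 0) := by
    simpa only [h0] using hc.tendsto 0
  filter_upwards [ht.eventually (eventually_continuousAt_boundaryHeight hφ),
    hU.mem_nhds hU_zero] with p hp hpU hlt
  rw [mem_interior_iff_mem_nhds]
  have hcp : ContinuousAt (fun q : Space => boundaryHeight φ ![q 0, q 1]) p :=
    ContinuousAt.comp (f := fun q : Space => (![q 0, q 1] : Plane)) hp hc.continuousAt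
  filter_upwards [hU.mem_nhds hpU,
    (continuous_apply 2).continuousAt.eventually_lt hcp hlt] with q hqU hq
  exact ⟨hqU, hq.le⟩

/-- The mean curvatures of the paraboloids converge as the parameters and the point tend to zero. -/
lemma exists_tendsto_surfaceH {φ : ℝ → ℝ} (hφ : ContDiffAt ℝ ∞ φ 0) (hφ_zero : φ 0 = 0)
    {U : Set Space} (hU : IsOpen U) (hU_zero : (0 : Space) ∈ U) {g : MetricField}
    (hg_smooth : ∀ i j, ContDiffOn ℝ ∞ (fun p => g p i j) (localBody φ U))
    (hg_pos : ∀ p ∈ localBody φ U, (g p).PosDef) :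
    ∃ H₀ : ℝ, Tendsto (fun q : ℝ × ℝ × Plane => surfaceH φ g q.1 q.2.1 q.2.2)
      (𝓝 0 ⊓ 𝓟 {q | paraboloid φ (g 0) q.1 q.2.1 q.2.2 < boundaryHeight φ q.2.2}) (𝓝 H₀) := by
  have h0 := zero_mem_localBody hφ_zero hU_zero
  have hD : ∀ i j, ∃ D : Space →L[ℝ] ℝ, Tendsto (fderiv ℝ fun p => g p i j)
      (𝓝[interior (localBody φ U)] 0) (𝓝 D) := fun i j =>
    exists_tendsto_fderiv_interior ((hg_smooth i j 0 h0).of_le (by simp)) h0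
  choose D hD using hD
  set l := 𝓝 (0 : ℝ × ℝ × Plane) ⊓
    𝓟 {q | paraboloid φ (g 0) q.1 q.2.1 q.2.2 < boundaryHeight φ q.2.2}
  have hl : l ≤ 𝓝 0 := inf_le_left
  have hF := (tendsto_graphMap_paraboloid φ (g 0)).mono_left hl
  -- `dMetric` takes full derivatives, which the smoothness of `g` on the body controls only at
  -- interior points.
  have hFi : Tendsto (fun q : ℝ × ℝ × Plane => graphMap (paraboloid φ (g 0) q.1 q.2.1) q.2.2) l
      (𝓝[interior (localBody φ U)] 0) := by
    refine tendsto_nhdsWithin_iff.2 ⟨hF, ?_⟩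
    filter_upwards [hF.eventually (eventually_mem_interior_localBody hφ hU hU_zero),
      (inf_le_right : l ≤ _) (mem_principal_self _)] with q hq hlt
    refine hq ?_
    have h : (![q.2.2 0, q.2.2 1] : Plane) = q.2.2 := by ext i; fin_cases i <;> rfl
    simpa [graphMap, h] using hlt
  have hgt : Tendsto (fun q : ℝ × ℝ × Plane =>
      g (graphMap (paraboloid φ (g 0) q.1 q.2.1) q.2.2)) l (𝓝 (g 0)) :=
    tendsto_pi_nhds.2 fun i => tendsto_pi_nhds.2 fun j =>
      ((hg_smooth i j).continuousOn 0 h0).tendsto.comp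
        (hFi.mono_right (nhdsWithin_mono 0 interior_subset))
  have hDt : ∀ k i j, Tendsto (fun q : ℝ × ℝ × Plane =>
      dMetric g (graphMap (paraboloid φ (g 0) q.1 q.2.1) q.2.2) k i j) l
      (𝓝 (D i j (Pi.single k 1))) := fun k i j =>
    (((ContinuousLinearMap.apply ℝ ℝ (Pi.single k 1 : Space)).continuous.tendsto _).comp
      ((hD i j).comp hFi))
  have hx : ∀ α, Tendsto (fun q : ℝ × ℝ × Plane => q.2.2 α) l (𝓝 0) := fun α =>
    (((continuous_apply α).comp (continuous_snd.comp continuous_snd)).tendsto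
      (0 : ℝ × ℝ × Plane)).mono_left hl
  have hs : Tendsto (fun q : ℝ × ℝ × Plane => q.1) l (𝓝 0) :=
    (continuous_fst.tendsto (0 : ℝ × ℝ × Plane)).mono_left hl
  unfold surfaceH
  simp only [paraboloid_eq_diagQuadratic] at hgt hDt ⊢
  refine tendsto_meanCurvature_diagQuadratic (hg_pos 0 h0)
    (c₀ := ![deriv φ 0 * (bCoeff (g 0) 0 - 1), deriv φ 0 * (bCoeff (g 0) 1 - 1)])
    (fun α => ?_) hx hgt hDt
  fin_cases α
  · simpa using (hs.const_add (bCoeff (g 0) 0 - 1)).const_mul (deriv φ 0)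
  · simpa using (hs.const_add (bCoeff (g 0) 1 - 1)).const_mul (deriv φ 0)

/-- `Plane` carries the sup norm, which the Euclidean length dominates. -/
lemma norm_lt_of_sqNorm_lt {x : Plane} {r : ℝ} (hr : 0 < r) (h : sqNorm x < r ^ 2) : ‖x‖ < r := by
  rw [pi_norm_lt_iff hr]
  unfold sqNorm at h
  intro i
  refine abs_lt_of_sq_lt_sq ?_ hr.le
  fin_cases i
  · change x 0 ^ 2 < r ^ 2
    nlinarith [sq_nonneg (x 1)]
  · change x 1 ^ 2 < r ^ 2
    nlinarith [sq_nonneg (x 0)]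

/-- The points near the pole where the paraboloid does not lie above the boundary are confined to a
disk of radius proportional to `t`. -/
lemma exists_sqNorm_le_of_paraboloid_le {φ : ℝ → ℝ} (hφ : ContDiffAt ℝ ∞ φ 0) (hφ_zero : φ 0 = 0)
    (hφ_deriv : 0 < deriv φ 0) {A : Matrix (Fin 3) (Fin 3) ℝ} (hA : A.PosDef) :
    ∃ c > 0, ∀ᶠ x in 𝓝 (0 : Plane), ∀ s > 0, ∀ t,
      paraboloid φ A s t x ≤ boundaryHeight φ x → c * sqNorm x ≤ t ^ 2 := by
  set m := min (bCoeff A 0) (bCoeff A 1)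
  have hm : 0 < m := lt_min (bCoeff_pos hA 0) (bCoeff_pos hA 1)
  have hc : 0 < deriv φ 0 * m / 2 := by positivity
  -- The paraboloid and the linear part of `φ` together give `φ'(0) m |x|² ≤ t² + o(|x|²)`; half of
  -- the left side pays for the error.
  refine ⟨deriv φ 0 * m / 2, hc, ?_⟩
  have hd : HasDerivAt φ (deriv φ 0) 0 := (hφ.differentiableAt (by simp)).hasDerivAt
  filter_upwards [tendsto_sqNorm_zero.eventually (hd.isLittleO.def hc)] with x hx s hs t hle
  have hr : 0 ≤ sqNorm x := by unfold sqNorm; positivity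
  simp only [hφ_zero, sub_zero, smul_eq_mul, Real.norm_eq_abs, abs_of_nonneg hr] at hx
  have hlow := (abs_le.1 hx).1
  have h0 : deriv φ 0 * x 0 ^ 2 * m ≤ deriv φ 0 * x 0 ^ 2 * (bCoeff A 0 + s) := by
    gcongr
    linarith [min_le_left (bCoeff A 0) (bCoeff A 1)]
  have h1 : deriv φ 0 * x 1 ^ 2 * m ≤ deriv φ 0 * x 1 ^ 2 * (bCoeff A 1 + s) := by
    gcongr
    linarith [min_le_right (bCoeff A 0) (bCoeff A 1)]
  unfold paraboloid boundaryHeight at hle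
  have hsq : sqNorm x = x 0 ^ 2 + x 1 ^ 2 := rfl
  generalize φ (sqNorm x) = y at hle hlow
  rw [hsq] at hlow ⊢
  nlinarith

end SphericalPole

theorem proposition5p13
    (φ : ℝ → ℝ) (hφ : ContDiffAt ℝ ∞ φ 0) (hφ_zero : φ 0 = 0) (hφ_deriv : 0 < deriv φ 0)
    (U : Set Space) (hU : IsOpen U) (hU_zero : (0 : Space) ∈ U)
    (g : MetricField)
    (hg_smooth : ∀ i j, ContDiffOn ℝ ∞ (fun p => g p i j) (localBody φ U))
    (hg_pos : ∀ p ∈ localBody φ U, (g p).PosDef)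
    (hg_axes : g 0 0 1 = 0) :
    ∃ H₀ : ℝ,
      -- the limit of the mean curvatures of the surfaces with `s = 0`, as they shrink to the pole
      Tendsto (fun q : ℝ × Plane => surfaceH φ g 0 q.1 q.2)
        ((𝓝[>] (0 : ℝ) ×ˢ 𝓝 (0 : Plane)) ⊓
          𝓟 {q | paraboloid φ (g 0) 0 q.1 q.2 < boundaryHeight φ q.2})
        (𝓝 H₀) ∧
      (0 < H₀ →
        ∃ ρ₀ > 0, ∀ ρ, 0 < ρ → ρ ≤ ρ₀ → ∃ s > 0, ∃ t > 0,
          -- the surface together with its boundary is compact, and it lies in the body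
          (∀ x, sqNorm x ≤ ρ ^ 2 → paraboloid φ (g 0) s t x ≤ boundaryHeight φ x →
            sqNorm x < ρ ^ 2 ∧ graphMap (paraboloid φ (g 0) s t) x ∈ localBody φ U) ∧
          (∀ x ∈ surfaceBase φ (g 0) ρ s t, 0 < surfaceH φ g s t x) ∧
          (∀ x ∈ boundaryBase φ (g 0) ρ s t, modelAngle φ x < contactAngle φ g s t x)) := by
  obtain ⟨H₀, hH⟩ := exists_tendsto_surfaceH hφ hφ_zero hU hU_zero hg_smooth hg_pos
  refine ⟨H₀, ?_, fun hpos => ?_⟩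
  · refine hH.comp (f := fun q : ℝ × Plane => ((0 : ℝ), q.1, q.2)) ?_
    refine tendsto_inf.2 ⟨?_, tendsto_principal.2 ?_⟩
    · have h : Tendsto (fun q : ℝ × Plane => ((0 : ℝ), q.1, q.2)) (𝓝 0) (𝓝 0) := by
        have hc : Continuous fun q : ℝ × Plane => ((0 : ℝ), q.1, q.2) := by fun_prop
        exact hc.tendsto 0
      refine h.mono_left (inf_le_left.trans ?_)
      rw [Prod.zero_eq_mk, nhds_prod_eq]
      exact prod_mono nhdsWithin_le_nhds le_rfl
    · exact (inf_le_right : _ ⊓ 𝓟 _ ≤ _) (mem_principal_self _)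
  have hA := hg_pos 0 (zero_mem_localBody hφ_zero hU_zero)
  have hg : ContinuousOn g (localBody φ U) :=
    continuousOn_pi.2 fun i => continuousOn_pi.2 fun j => (hg_smooth i j).continuousOn
  have hHpos := eventually_inf_principal.1 (hH.eventually_const_lt hpos)
  have hUev := (tendsto_graphMap_paraboloid φ (g 0)).eventually (hU.mem_nhds hU_zero)
  obtain ⟨ε, hε, hball⟩ := Metric.eventually_nhds_iff.1 (hHpos.and hUev)
  obtain ⟨c, hc, hconf⟩ := exists_sqNorm_le_of_paraboloid_le hφ hφ_zero hφ_deriv hA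
  obtain ⟨ε', hε', hconf⟩ := Metric.eventually_nhds_iff.1 hconf
  have hnear : ∀ s t : ℝ, ∀ x : Plane, 0 < s → s < ε → 0 < t → t < ε → ‖x‖ < ε →
      dist (s, t, x) 0 < ε := fun s t x hs hsε ht htε hx => by
    simp only [dist_zero_right, Prod.norm_mk, Real.norm_eq_abs, abs_of_pos hs, abs_of_pos ht]
    exact max_lt hsε (max_lt htε hx)
  refine ⟨min ε ε' / 2, by positivity, fun ρ hρ hρ₀ => ?_⟩
  have hρmin : ρ < min ε ε' := hρ₀.trans_lt (half_lt_self (lt_min hε hε'))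
  have hρε : ρ < ε := hρmin.trans_le (min_le_left _ _)
  have hρε' : ρ < ε' := hρmin.trans_le (min_le_right _ _)
  have hnorm : ∀ x, sqNorm x ≤ ρ ^ 2 → ‖x‖ < min ε ε' := fun x hx =>
    norm_lt_of_sqNorm_lt (hρ.trans hρmin) (hx.trans_lt (by gcongr))
  -- With `s = ε / 2` now fixed, `δ` depends on `s` but not on `t`, so `t` can still be shrunk.
  obtain ⟨δ, hδ, hangle⟩ := Metric.eventually_nhds_iff.1
    (eventually_modelAngle_lt_contactAngle hφ hφ_zero hφ_deriv hU hU_zero hg hg_pos hg_axes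
      (half_pos hε))
  set r := min ρ δ
  have hr : 0 < r := lt_min hρ hδ
  -- The second bound gives `t² < c r²`, so confinement puts the surface strictly inside radius `r ≤
  -- ρ, δ`.
  set t := min (ε / 2) (√c * r / 2)
  have ht : 0 < t := lt_min (half_pos hε) (by positivity)
  have htε : t < ε := (min_le_left _ _).trans_lt (half_lt_self hε)
  have htr : t ^ 2 < c * r ^ 2 := by
    have h : t < √c * r := (min_le_right _ _).trans_lt (half_lt_self (by positivity))
    calc t ^ 2 < (√c * r) ^ 2 := by gcongr
      _ = c * r ^ 2 := by rw [mul_pow, Real.sq_sqrt hc.le]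
  have hsmall : ∀ x, sqNorm x ≤ ρ ^ 2 → paraboloid φ (g 0) (ε / 2) t x ≤ boundaryHeight φ x →
      sqNorm x < r ^ 2 := fun x hx hle => by
    have h := hconf (by simpa using (hnorm x hx).trans_le (min_le_right _ _)) (ε / 2) (half_pos hε)
      t hle
    exact lt_of_mul_lt_mul_left (h.trans_lt htr) hc.le
  refine ⟨ε / 2, half_pos hε, t, ht, fun x hx hle => ⟨?_, ?_⟩, fun x hx => ?_, fun x hx => ?_⟩
  · exact (hsmall x hx hle).trans_le (by gcongr; exact min_le_left _ _)
  · exact graphMap_mem_localBody.2 ⟨(hball (hnear _ _ x (half_pos hε) (half_lt_self hε) ht htε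
      ((hnorm x hx).trans_le (min_le_left _ _)))).2, hle⟩
  · exact (hball (hnear _ _ x (half_pos hε) (half_lt_self hε) ht htε
      ((hnorm x hx.1.le).trans_le (min_le_left _ _)))).1 hx.2
  · have hxδ : ‖x‖ < δ :=
      (norm_lt_of_sqNorm_lt hr (hsmall x hx.1.le hx.2.le)).trans_le (min_le_right _ _)
    refine hangle (by simpa using hxδ) ?_ t
    -- The pole is not a boundary point: there the paraboloid has height `-t² < 0`.
    rintro rfl
    have h := hx.2
    rw [boundaryHeight_zero hφ_zero] at h
    simp [paraboloid] at h
    exact ht.ne' h
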